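/- Let $\Bbbk$ be an algebraically closed field of characteristic $0$, let $\mathcal S=\Bbbk[X_0,\dots,X_n]$, and let $\mathcal R=\Bbbk[Y_0,\dots,Y_n]$ be its dual ring, acting on $\mathcal S$ by differentiation ($Y_i\circ F=\partial F/\partial X_i$) and identified with the coordinate ring of $\mathbb P^n=\mathbb P(\mathcal S_1)$. For a nonzero linear form $L\in\mathcal S_1$ let $\wp_L\subset\mathcal R$ be the homogeneous ideal of the point $[L]\in\mathbb P^n$. A $0$-dimensional scheme $Z\subset\mathbb P^n$ with saturated homogeneous ideal $I(Z)\subseteq\mathcal R$ is apolar to $F\in\mathcal S_d$ if $G\circ F=0$ for all $G\in I(Z)$. For $F\in\mathcal S_d$ and $0\ne L\in\mathcal S_1$, complete $L$ to a basis $L=L_0',L_1',\dots,L_n'$ of $\mathcal S_1$ and write $F=\sum_{|\alpha|=d}c_\alpha\prod_{m=0}^n (L_m')^{\alpha_m}/\alpha_m!$. Put $f_L=\sum_\alpha c_\alpha\, x_1^{[\alpha_1]}\cdots x_n^{[\alpha_n]}$ in divided powers. The natural apolar scheme $Z_{F,L}$ is the closed subscheme of $\mathbb P^n$ supported at $[L]$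 (empty if $F=0$) which, in the affine chart $(y_1,\dots,y_n)\mapsto[L+y_1L_1'+\dots+y_nL_n']$, is defined by the ideal of all $g\in\Bbbk[y_1,\dots,y_n]$ that annihilate $f_L$ under contraction ($y^\beta$ sends $x^{[\alpha]}$ to $x^{[\alpha-\beta]}$ if $\beta\le\alpha$ componentwise, and to $0$ otherwise). It does not depend on the choice of the basis. A generalized additive decomposition (GAD) of $F\in\mathcal S_d$ supported at a finite family of pairwise non-proportional nonzero linear forms $(L_i)_{i\in J}$ is an expression $F=\sum_{i\in J}L_i^{d-k_i}G_i$ with $0\le k_i\le d$ and $G_i\in\mathcal S_{k_i}$ not divisible by $L_i$ (for $F=0$ the empty decomposition is allowed). The scheme evinced by it is $\bigcup_{i\in J}Z_{L_i^{d-k_i}G_i,\,L_i}$. **Corollary.** Let $F\in\mathcal S_d$, let $L_1,\dots,L_s\in\mathcal S_1$ be nonzero linear forms, and let $Z=Z_1\cup\dots\cup Z_s\subset\mathbb P^n$ be a $0$-dimensional scheme apolar to $F$ such that for every $i\in\{1,\dots,s\}$ we have $I(Z_i)\supseteq\wp_{L_i}^{\tilde k_i+1}$ for some integer $0\le\tilde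 k_i\le d$. Then there is a subset $J\subseteq\{1,\dots,s\}$ and a GAD $$F=\sum_{i\in J}L_i^{d-k_i}G_i$$ supported at $(L_i)_{i\in J}$, with $k_i\le\tilde k_i$ for every $i\in J$, such that $Z$ contains the scheme evinced by this GAD. -/

import Mathlib

noncomputable section

namespace GADScheme

/-! Both `S = 𝕜[X_0,…,X_n]` and its dual ring `R = 𝕜[Y_0,…,Y_n]` are modelled by
`MvPolynomial (Fin (n + 1)) 𝕜`. A linear form `L = ℓ_0 X_0 + … + ℓ_n X_n` is given by its
coefficient vector `ℓ`, which is also the coordinate vector of the point `[L]` of `ℙⁿ = ℙ(S_1)`,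
whose coordinate ring is `R`. -/

/-- The apolarity action of `R` on `S` by differentiation: the bilinear extension of
`Y^β ∘ X^α = α! / (α - β)! X^(α - β)` if `β ≤ α`, and `0` otherwise. -/
def diffAct {𝕜 : Type*} [Field 𝕜] {σ : Type*} [Fintype σ] (G F : MvPolynomial σ 𝕜) :
    MvPolynomial σ 𝕜 :=
  open Classical in
  ∑ β ∈ G.support, ∑ α ∈ F.support,
    if β ≤ α then
      MvPolynomial.monomial (α - β)
        (G.coeff β * F.coeff α * ∏ i, ((α i).descFactorial (β i) : 𝕜))
    else 0

/-! ### Closed subschemes of projective space -/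

/-- A closed subscheme `Z` of `ℙⁿ`, given by its saturated homogeneous ideal `I(Z) ⊆ R`. -/
@[ext] structure ProjSubscheme (𝕜 : Type*) [Field 𝕜] (n : ℕ) where
  /-- the ideal `I(Z)` -/
  ideal : Ideal (MvPolynomial (Fin (n + 1)) 𝕜)
  homogeneous : ∀ G ∈ ideal, ∀ e, MvPolynomial.homogeneousComponent e G ∈ ideal
  saturated : ∀ G, (∀ i, MvPolynomial.X i * G ∈ ideal) → G ∈ ideal

/-- `Z` contains `W` as a closed subscheme. -/
def ProjSubscheme.Contains {𝕜 : Type*} [Field 𝕜] {n : ℕ} (Z W : ProjSubscheme 𝕜 n) : Prop :=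
  Z.ideal ≤ W.ideal

/-- `Z` has dimension at most zero (the empty scheme is allowed): the affine cone over `Z` has
dimension at most one. -/
def ProjSubscheme.IsZeroDim {𝕜 : Type*} [Field 𝕜] {n : ℕ} (Z : ProjSubscheme 𝕜 n) : Prop :=
  ringKrullDim (MvPolynomial (Fin (n + 1)) 𝕜 ⧸ Z.ideal) ≤ 1

/-- The scheme-theoretic union, defined by the intersection of the ideals. The union of the empty
family is the empty scheme. -/
def ProjSubscheme.union {𝕜 : Type*} [Field 𝕜] {n : ℕ} {ι : Type*}
    (Z : ι → ProjSubscheme 𝕜 n) : ProjSubscheme 𝕜 n where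
  ideal := ⨅ i, (Z i).ideal
  homogeneous G hG e := by
    rw [Ideal.mem_iInf] at hG ⊢
    exact fun i => (Z i).homogeneous G (hG i) e
  saturated G hG := by
    simp only [Ideal.mem_iInf] at hG ⊢
    exact fun i => (Z i).saturated G fun j => hG j i

/-- `Z` is apolar to `F`: `I(Z) ⊆ Ann(F)`. -/
def ProjSubscheme.IsApolar {𝕜 : Type*} [Field 𝕜] {n : ℕ} (Z : ProjSubscheme 𝕜 n)
    (F : MvPolynomial (Fin (n + 1)) 𝕜) : Prop :=
  ∀ G ∈ Z.ideal, diffAct G F = 0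

/-- The homogeneous ideal generated by the forms that belong to `K`. -/
def formsIdeal {𝕜 : Type*} [Field 𝕜] {n : ℕ} (K : Ideal (MvPolynomial (Fin (n + 1)) 𝕜)) :
    Ideal (MvPolynomial (Fin (n + 1)) 𝕜) :=
  Ideal.span {G | G ∈ K ∧ ∃ e, G.IsHomogeneous e}

theorem formsIdeal_le {𝕜 : Type*} [Field 𝕜] {n : ℕ}
    (K : Ideal (MvPolynomial (Fin (n + 1)) 𝕜)) : formsIdeal K ≤ K :=
  Ideal.span_le.2 fun _ h => h.1

theorem formsIdeal_homogeneous {𝕜 : Type*} [Field 𝕜] {n : ℕ}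
    (K : Ideal (MvPolynomial (Fin (n + 1)) 𝕜))
    (G : MvPolynomial (Fin (n + 1)) 𝕜) (hG : G ∈ formsIdeal K) (e : ℕ) :
    MvPolynomial.homogeneousComponent e G ∈ formsIdeal K := by
  let _ := MvPolynomial.gradedAlgebra (σ := Fin (n + 1)) (R := 𝕜)
  have h : (formsIdeal K).IsHomogeneous (MvPolynomial.homogeneousSubmodule (Fin (n + 1)) 𝕜) :=
    Ideal.homogeneous_span _ _ fun x hx => hx.2
  exact (MvPolynomial.mem_iff_homogeneousComponent_mem h G).1 hG e

/-- The homogeneous ideal `℘_L` of the simple point `[L]`: it is generated by the forms that vanish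
at the point with coordinate vector `ℓ`. -/
def pointIdeal {𝕜 : Type*} [Field 𝕜] {n : ℕ} (ℓ : Fin (n + 1) → 𝕜) :
    Ideal (MvPolynomial (Fin (n + 1)) 𝕜) :=
  formsIdeal (RingHom.ker (MvPolynomial.eval ℓ))

/-! ### Divided powers and contraction

An element of a divided power ring is written as an `MvPolynomial` whose coefficient at `α` is the
coefficient of the divided power monomial `X^[α] = X^α / α!`. -/

/-- `F ↦ F_dp`, the expression of a polynomial in the divided power basis. -/
def toDP {𝕜 : Type*} [Field 𝕜] {σ : Type*} [Fintype σ] (F : MvPolynomial σ 𝕜) :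
    MvPolynomial σ 𝕜 :=
  ∑ α ∈ F.support, MvPolynomial.monomial α (F.coeff α * ∏ i, ((α i).factorial : 𝕜))

/-- The contraction action: the bilinear extension of `Y^β ⌟ X^[α] = X^[α - β]` if `β ≤ α`, and
`0` otherwise. Here `f.divMonomial β` is Mathlib's name for `Y^β ⌟ f`. -/
def contract {𝕜 : Type*} [Field 𝕜] {σ : Type*} (G f : MvPolynomial σ 𝕜) : MvPolynomial σ 𝕜 :=
  ∑ β ∈ G.support, G.coeff β • f.divMonomial β

theorem contract_eq_sum {𝕜 : Type*} [Field 𝕜] {σ : Type*} (G f : MvPolynomial σ 𝕜)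
    (T : Finset (σ →₀ ℕ)) (hT : G.support ⊆ T) :
    contract G f = ∑ β ∈ T, G.coeff β • f.divMonomial β := by
  refine Finset.sum_subset hT fun β _ hβ => ?_
  rw [MvPolynomial.notMem_support_iff.mp hβ, zero_smul]

theorem contract_add {𝕜 : Type*} [Field 𝕜] {σ : Type*} (G H f : MvPolynomial σ 𝕜) :
    contract (G + H) f = contract G f + contract H f := by
  classical
  rw [contract_eq_sum (G + H) f (G.support ∪ H.support) MvPolynomial.support_add,
    contract_eq_sum G f (G.support ∪ H.support) Finset.subset_union_left,
    contract_eq_sum H f (G.support ∪ H.support) Finset.subset_union_right,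
    ← Finset.sum_add_distrib]
  exact Finset.sum_congr rfl fun β _ => by rw [MvPolynomial.coeff_add, add_smul]

theorem contract_monomial {𝕜 : Type*} [Field 𝕜] {σ : Type*} (β : σ →₀ ℕ) (b : 𝕜)
    (f : MvPolynomial σ 𝕜) :
    contract (MvPolynomial.monomial β b) f = b • f.divMonomial β := by
  classical
  rw [contract_eq_sum _ f {β} MvPolynomial.support_monomial_subset]
  simp

theorem contract_monomial_mul {𝕜 : Type*} [Field 𝕜] {σ : Type*} (β : σ →₀ ℕ) (b : 𝕜)
    (H f : MvPolynomial σ 𝕜) :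
    contract (MvPolynomial.monomial β b * H) f = b • (contract H f).divMonomial β := by
  induction H using MvPolynomial.induction_on' with
  | monomial γ c =>
    rw [MvPolynomial.monomial_mul, contract_monomial, contract_monomial]
    ext δ
    simp only [MvPolynomial.coeff_smul, MvPolynomial.coeff_divMonomial, smul_eq_mul]
    rw [add_comm β γ, add_assoc, mul_assoc]
  | add p q hp hq =>
    rw [mul_add, contract_add, hp, hq, contract_add, MvPolynomial.add_divMonomial, smul_add]

/-- The annihilator of `f` with respect to contraction. -/
def contractAnn {𝕜 : Type*} [Field 𝕜] {σ : Type*} (f : MvPolynomial σ 𝕜) :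
    Ideal (MvPolynomial σ 𝕜) where
  carrier := {g | contract g f = 0}
  zero_mem' := by simp [contract]
  add_mem' {g h} hg hh := by
    change contract (g + h) f = 0
    rw [contract_add, show contract g f = 0 from hg, show contract h f = 0 from hh, add_zero]
  smul_mem' c {g} hg := by
    change contract (c * g) f = 0
    replace hg : contract g f = 0 := hg
    induction c using MvPolynomial.induction_on' with
    | monomial β b => rw [contract_monomial_mul, hg, MvPolynomial.zero_divMonomial, smul_zero]
    | add p q hp hq => rw [add_mul, contract_add, hp, hq, add_zero]

/-! ### Natural apolar schemes

Fix `ℓ` and an index `j` with `ℓ_j ≠ 0`. The linear form `L` and the variables `X_m`, `m ≠ j`, form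
a basis of `S_1`; the `m ≠ j` are listed in increasing order as `j.succAbove i`, `i : Fin n`. -/

/-- The linear form `L = ∑ ℓ_m X_m`. -/
def linearForm {𝕜 : Type*} [Field 𝕜] {n : ℕ} (ℓ : Fin (n + 1) → 𝕜) :
    MvPolynomial (Fin (n + 1)) 𝕜 :=
  ∑ m, MvPolynomial.C (ℓ m) * MvPolynomial.X m

/-- The change of coordinates `φ` on `S` with `φ(L) = X_0` and `φ(X_{j.succAbove i}) = X_{i+1}`. -/
def changeCoords {𝕜 : Type*} [Field 𝕜] {n : ℕ} (ℓ : Fin (n + 1) → 𝕜) (j : Fin (n + 1)) :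
    MvPolynomial (Fin (n + 1)) 𝕜 →ₐ[𝕜] MvPolynomial (Fin (n + 1)) 𝕜 :=
  MvPolynomial.aeval
    (j.insertNth (α := fun _ => MvPolynomial (Fin (n + 1)) 𝕜)
      (MvPolynomial.C (ℓ j)⁻¹ * (MvPolynomial.X 0 -
        ∑ i : Fin n, MvPolynomial.C (ℓ (j.succAbove i)) * MvPolynomial.X i.succ))
      fun i => MvPolynomial.X i.succ)

/-- The dehomogenization `f_L = F̃_dp(1, x_1, …, x_n)` of `F` by `L`, where `F̃ = φ(F)`. The divided
power monomial `X_0^[a] x^[β]` is sent to `x^[β]`. -/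
def localization {𝕜 : Type*} [Field 𝕜] {n : ℕ} (F : MvPolynomial (Fin (n + 1)) 𝕜)
    (ℓ : Fin (n + 1) → 𝕜) (j : Fin (n + 1)) : MvPolynomial (Fin n) 𝕜 :=
  MvPolynomial.aeval
    (Fin.cons 1 MvPolynomial.X : Fin (n + 1) → MvPolynomial (Fin n) 𝕜)
    (toDP (changeCoords ℓ j F))

/-- Restriction of the coordinate ring `R` to the affine chart of `ℙⁿ` centred at `[L]` with the
coordinates dual to the above basis of `S_1`: a form `G` is sent to
`G(ℓ + y_1 e_{j.succAbove 0} + … + y_n e_{j.succAbove (n-1)})`. -/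
def chart {𝕜 : Type*} [Field 𝕜] {n : ℕ} (ℓ : Fin (n + 1) → 𝕜) (j : Fin (n + 1)) :
    MvPolynomial (Fin (n + 1)) 𝕜 →ₐ[𝕜] MvPolynomial (Fin n) 𝕜 :=
  MvPolynomial.aeval fun m =>
    MvPolynomial.C (ℓ m) + j.insertNth (α := fun _ => MvPolynomial (Fin n) 𝕜) 0 MvPolynomial.X m

theorem homogeneousComponent_X_mul {𝕜 : Type*} [Field 𝕜] {n : ℕ} (j : Fin (n + 1))
    (G : MvPolynomial (Fin (n + 1)) 𝕜) (e : ℕ) :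
    MvPolynomial.homogeneousComponent (e + 1) (MvPolynomial.X j * G)
      = MvPolynomial.X j * MvPolynomial.homogeneousComponent e G := by
  classical
  ext m
  rw [MvPolynomial.coeff_homogeneousComponent, MvPolynomial.coeff_X_mul',
    MvPolynomial.coeff_X_mul', MvPolynomial.coeff_homogeneousComponent]
  by_cases hm : j ∈ m.support
  · have h1 : Finsupp.single j 1 ≤ m := by
      rw [Finsupp.single_le_iff]
      exact Nat.one_le_iff_ne_zero.2 (Finsupp.mem_support_iff.1 hm)
    have h2 : m.degree = (m - Finsupp.single j 1).degree + 1 := by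
      conv_lhs => rw [← tsub_add_cancel_of_le h1]
      simp
    simp [hm, h2]
  · simp [hm]

theorem formsIdeal_chart_saturated {𝕜 : Type*} [Field 𝕜] {n : ℕ} (ℓ : Fin (n + 1) → 𝕜)
    (j : Fin (n + 1)) (hj : ℓ j ≠ 0)
    (J : Ideal (MvPolynomial (Fin n) 𝕜)) (G : MvPolynomial (Fin (n + 1)) 𝕜)
    (hG : ∀ i, MvPolynomial.X i * G ∈ formsIdeal (J.comap (chart ℓ j))) :
    G ∈ formsIdeal (J.comap (chart ℓ j)) := by
  rw [← MvPolynomial.sum_homogeneousComponent G]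
  refine Ideal.sum_mem _ fun e _ => Ideal.subset_span
    ⟨?_, e, MvPolynomial.homogeneousComponent_isHomogeneous e G⟩
  have h1 := formsIdeal_le _ (formsIdeal_homogeneous _ _ (hG j) (e + 1))
  rw [homogeneousComponent_X_mul, Ideal.mem_comap, map_mul] at h1
  have h3 : chart ℓ j (MvPolynomial.X j) = MvPolynomial.C (ℓ j) := by simp [chart]
  rw [h3] at h1
  have h4 := J.mul_mem_left (MvPolynomial.C (ℓ j)⁻¹) h1
  rwa [← mul_assoc, ← map_mul, inv_mul_cancel₀ hj, map_one, one_mul] at h4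

/-- The natural apolar scheme `Z_{F,L}` to `F` supported at `[L]`: the closed subscheme of `ℙⁿ`
locally defined by the contraction annihilator of `f_L` in the affine chart centred at `[L]`.
Its homogeneous ideal is generated by the forms whose restriction to the chart annihilates `f_L`.
It does not depend on the index `j` with `ℓ_j ≠ 0` used to fix the coordinates. -/
def naturalApolarScheme {𝕜 : Type*} [Field 𝕜] {n : ℕ} (F : MvPolynomial (Fin (n + 1)) 𝕜)
    (ℓ : Fin (n + 1) → 𝕜) (hℓ : ℓ ≠ 0) : ProjSubscheme 𝕜 n :=
  let j := Classical.choose (Function.ne_iff.1 hℓ)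
  { ideal := formsIdeal ((contractAnn (localization F ℓ j)).comap (chart ℓ j))
    homogeneous := formsIdeal_homogeneous _
    saturated := formsIdeal_chart_saturated ℓ j (Classical.choose_spec (Function.ne_iff.1 hℓ)) _ }

/-! ### Generalized additive decompositions -/

/-- A generalized additive decomposition `F = ∑ i, L_i ^ (d - k_i) * G_i` of `F ∈ S_d`, indexed by
the finite type `ι`. -/
structure GAD {𝕜 : Type*} [Field 𝕜] {n : ℕ} (d : ℕ) (F : MvPolynomial (Fin (n + 1)) 𝕜)
    (ι : Type*) [Fintype ι] where
  /-- the coefficient vectors of the linear forms `L_i` -/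
  L : ι → Fin (n + 1) → 𝕜
  L_ne_zero : ∀ i, L i ≠ 0
  not_proportional : ∀ i j, i ≠ j → ∀ c : 𝕜, L i ≠ c • L j
  /-- the degrees of the `G_i` -/
  k : ι → ℕ
  k_le : ∀ i, k i ≤ d
  /-- the cofactors `G_i` -/
  G : ι → MvPolynomial (Fin (n + 1)) 𝕜
  G_homogeneous : ∀ i, (G i).IsHomogeneous (k i)
  not_dvd : ∀ i, ¬ linearForm (L i) ∣ G i
  sum_eq : F = ∑ i, linearForm (L i) ^ (d - k i) * G i

/-- The scheme evinced by a GAD: the union of the natural apolar schemes to the summands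
`L_i ^ (d - k_i) * G_i` supported at the `[L_i]`. -/
def GAD.scheme {𝕜 : Type*} [Field 𝕜] {n d : ℕ} {F : MvPolynomial (Fin (n + 1)) 𝕜} {ι : Type*}
    [Fintype ι] (D : GAD d F ι) : ProjSubscheme 𝕜 n :=
  ProjSubscheme.union fun i =>
    naturalApolarScheme (linearForm (D.L i) ^ (d - D.k i) * D.G i) (D.L i) (D.L_ne_zero i)

end GADScheme

end

/-!
A form `F` of degree `d` to which `Z` is apolar is orthogonal to `I(Z)` for the pairing
`⟨F, H⟩ = (H ∘ F)(0)`. Since this pairing is perfect in degree `d`, orthogonal complements turn the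
intersection `I(Z) = ⋂ I(Z_i)` into a sum, so that `F = ∑ F_i` with `F_i` orthogonal to `I(Z_i)`.
Before splitting, the `Z_i` supported at the same point are merged.

It remains to study one `F_i`. Substitutions by transposed matrices are adjoint for the pairing, so
a projectivity moves the point to `(1 : 0 : ⋯ : 0)`. There `℘ ^ (k + 1) ⊆ I(Z_i)` means that
`I(Z_i)` contains every monomial of degree greater than `k` in `Y_1, …, Y_n`. Orthogonality to those
shows that `X_0 ^ (d - k)` divides `F_i`. Moreover `Y_0` is a nonzerodivisor modulo `I(Z_i)`,
because `I(Z_i)` is saturated; so an `H ∈ I(Z_i)` of large degree is, modulo these monomials, a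
power of `Y_0` times an element of `I(Z_i)` of degree `d`, and hence its dehomogenization
annihilates that of `F_i` by contraction.
-/

namespace GADScheme

open MvPolynomial

section DividedPowers

variable {𝕜 : Type*} [Field 𝕜] {σ : Type*}

/-- The perfect pairing between `𝕜[y]` and the divided power ring for which the monomials `y^β` and
`x^[β]` are dual to each other. The element of the divided power ring is the first argument. -/
noncomputable def dpPairing (𝕜 : Type*) [Field 𝕜] (σ : Type*) :
    MvPolynomial σ 𝕜 →ₗ[𝕜] MvPolynomial σ 𝕜 →ₗ[𝕜] 𝕜 :=
  ((basisMonomials σ 𝕜).constr 𝕜).toLinearMap ∘ₗ LinearMap.pi fun β => lcoeff 𝕜 β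

theorem dpPairing_monomial (f : MvPolynomial σ 𝕜) (β : σ →₀ ℕ) (c : 𝕜) :
    dpPairing 𝕜 σ f (monomial β c) = c * f.coeff β := by
  have hc : (monomial β c : MvPolynomial σ 𝕜) = c • basisMonomials σ 𝕜 β := by
    rw [coe_basisMonomials, smul_monomial, smul_eq_mul, mul_one]
  rw [hc, map_smul, smul_eq_mul, dpPairing, LinearMap.comp_apply, LinearEquiv.coe_coe,
    Module.Basis.constr_basis, LinearMap.pi_apply, lcoeff_apply]

theorem coeff_contract (g f : MvPolynomial σ 𝕜) (γ : σ →₀ ℕ) :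
    (contract g f).coeff γ = dpPairing 𝕜 σ f (monomial γ 1 * g) := by
  induction g using MvPolynomial.induction_on' with
  | monomial β c =>
    rw [contract_monomial, coeff_smul, coeff_divMonomial, monomial_mul, dpPairing_monomial,
      one_mul, add_comm, smul_eq_mul]
  | add p q hp hq => rw [contract_add, coeff_add, hp, hq, mul_add, map_add]

variable [Fintype σ]

theorem coeff_toDP (F : MvPolynomial σ 𝕜) (α : σ →₀ ℕ) :
    (toDP F).coeff α = F.coeff α * ∏ i, ((α i).factorial : 𝕜) := by
  classical
  simp only [toDP, coeff_sum, coeff_monomial]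
  rw [Finset.sum_ite_eq' F.support α, ite_eq_left_iff]
  intro hα
  rw [notMem_support_iff.1 hα, zero_mul]

theorem toDP_isHomogeneous {F : MvPolynomial σ 𝕜} {d : ℕ} (hF : F.IsHomogeneous d) :
    (toDP F).IsHomogeneous d :=
  IsHomogeneous.sum _ _ _ fun _ hα =>
    isHomogeneous_monomial _ (hF.degree_eq_sum_deg_support hα).symm

theorem prod_cast_factorial_ne_zero {R : Type*} [CommSemiring R] {α : σ →₀ ℕ}
    (hα : (α.degree.factorial : R) ≠ 0) : ∏ i, ((α i).factorial : R) ≠ 0 := by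
  obtain ⟨m, hm⟩ := Nat.prod_factorial_dvd_factorial_sum Finset.univ α
  rw [Finsupp.degree_eq_sum, hm, Nat.cast_mul, Nat.cast_prod] at hα
  exact left_ne_zero_of_mul hα

/-- The apolarity pairing `⟨F, G⟩ = (G ∘ F)(0) = ∑ α, α! F_α G_α`. -/
noncomputable def apolarPairing (𝕜 : Type*) [Field 𝕜] (σ : Type*) [Fintype σ] :
    MvPolynomial σ 𝕜 →ₗ[𝕜] MvPolynomial σ 𝕜 →ₗ[𝕜] 𝕜 :=
  dpPairing 𝕜 σ ∘ₗ
    { toFun := toDP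
      map_add' F G := by
        ext α
        simp only [coeff_toDP, coeff_add, add_mul]
      map_smul' c F := by
        ext α
        simp only [coeff_toDP, coeff_smul, smul_eq_mul, mul_assoc, RingHom.id_apply] }

theorem apolarPairing_apply (F : MvPolynomial σ 𝕜) :
    apolarPairing 𝕜 σ F = dpPairing 𝕜 σ (toDP F) :=
  rfl

theorem apolarPairing_monomial (F : MvPolynomial σ 𝕜) (β : σ →₀ ℕ) (c : 𝕜) :
    apolarPairing 𝕜 σ F (monomial β c) = c * (F.coeff β * ∏ i, ((β i).factorial : 𝕜)) := by
  rw [apolarPairing_apply, dpPairing_monomial, coeff_toDP]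

theorem coeff_zero_diffAct (G F : MvPolynomial σ 𝕜) :
    (diffAct G F).coeff 0 = apolarPairing 𝕜 σ F G := by
  classical
  conv_rhs => rw [G.as_sum, map_sum]
  rw [diffAct, coeff_sum]
  refine Finset.sum_congr rfl fun β _ => ?_
  rw [coeff_sum, apolarPairing_monomial, Finset.sum_eq_single β]
  · simp only [le_refl, if_true, tsub_self, coeff_monomial, Nat.descFactorial_self, mul_assoc]
  · intro α _ hne
    split_ifs with hle
    · rw [coeff_monomial, if_neg fun h0 => hne (le_antisymm (tsub_eq_zero_iff_le.1 h0) hle)]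
    · exact coeff_zero _
  · intro hβ
    simp only [notMem_support_iff.1 hβ, mul_zero, zero_mul, monomial_zero, ite_self, coeff_zero]

theorem apolarPairing_X_mul (F G : MvPolynomial σ 𝕜) (i : σ) :
    apolarPairing 𝕜 σ F (X i * G) = apolarPairing 𝕜 σ (pderiv i F) G := by
  classical
  induction G using MvPolynomial.induction_on' with
  | monomial β c =>
    have hfactorial : ∏ k, (((Finsupp.single i 1 + β : σ →₀ ℕ) k).factorial : 𝕜)
        = (β i + 1) * ∏ k, ((β k).factorial : 𝕜) := by
      rw [← Finset.mul_prod_erase _ _ (Finset.mem_univ i),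
        ← Finset.mul_prod_erase _ _ (Finset.mem_univ i), ← mul_assoc]
      congr 1
      · simp only [Finsupp.add_apply, Finsupp.single_eq_same, add_comm 1 (β i),
          Nat.factorial_succ, Nat.cast_mul, Nat.cast_add, Nat.cast_one]
      · refine Finset.prod_congr rfl fun k hk => ?_
        rw [Finsupp.add_apply, Finsupp.single_eq_of_ne (Finset.ne_of_mem_erase hk), zero_add]
    rw [X, monomial_mul, one_mul, apolarPairing_monomial, apolarPairing_monomial, coeff_pderiv,
      hfactorial, add_comm β]
    ring
  | add p q hp hq => rw [mul_add, map_add, map_add, hp, hq]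

theorem eq_of_apolarPairing_eq {F F' : MvPolynomial σ 𝕜} {d : ℕ} (hd : (d.factorial : 𝕜) ≠ 0)
    (hF : F.IsHomogeneous d) (hF' : F'.IsHomogeneous d)
    (h : ∀ H : MvPolynomial σ 𝕜, H.IsHomogeneous d →
      apolarPairing 𝕜 σ F H = apolarPairing 𝕜 σ F' H) : F = F' := by
  ext α
  by_cases hα : α.degree = d
  · have hpair := h (monomial α 1) (isHomogeneous_monomial _ hα)
    rw [apolarPairing_monomial, apolarPairing_monomial, one_mul, one_mul] at hpair
    exact mul_right_cancel₀ (prod_cast_factorial_ne_zero (hα ▸ hd)) hpair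
  · rw [hF.coeff_eq_zero hα, hF'.coeff_eq_zero hα]

theorem exists_form_apolarPairing_eq {d : ℕ} (hd : (d.factorial : 𝕜) ≠ 0)
    (φ : Module.Dual 𝕜 (MvPolynomial σ 𝕜)) :
    ∃ F : MvPolynomial σ 𝕜, F.IsHomogeneous d ∧
      ∀ H, apolarPairing 𝕜 σ F H = φ (homogeneousComponent d H) := by
  classical
  have hmem (α : σ →₀ ℕ) : α ∈ Finset.univ.finsuppAntidiag d ↔ α.degree = d := by
    simp [Finset.mem_finsuppAntidiag, Finsupp.degree_eq_sum]
  refine ⟨∑ α ∈ Finset.univ.finsuppAntidiag d,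
      monomial α (φ (monomial α 1) / ∏ i, ((α i).factorial : 𝕜)),
    IsHomogeneous.sum _ _ _ fun α hα => isHomogeneous_monomial _ ((hmem α).1 hα), fun H => ?_⟩
  induction H using MvPolynomial.induction_on' with
  | monomial β c =>
    have hβ : (monomial β c : MvPolynomial σ 𝕜) = c • monomial β 1 := by
      rw [smul_monomial, smul_eq_mul, mul_one]
    rw [apolarPairing_monomial, homogeneousComponent_of_mem (isHomogeneous_monomial c rfl),
      coeff_sum]
    simp only [coeff_monomial, Finset.sum_ite_eq', hmem]
    split_ifs with h1 h2 h2
    · rw [div_mul_cancel₀ _ (prod_cast_factorial_ne_zero (h1 ▸ hd)), hβ, map_smul, smul_eq_mul]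
    · exact absurd h1.symm h2
    · exact absurd h2.symm h1
    · rw [zero_mul, mul_zero, map_zero]
  | add p q hp hq => rw [map_add, map_add, map_add, hp, hq]

end DividedPowers

section LinearSubstitution

variable {R : Type*} [CommSemiring R] {σ τ υ : Type*} [Fintype τ]

/-- The substitution `X_i ↦ ∑ j, M_{ij} X_j`. -/
noncomputable def linearSubst (M : Matrix σ τ R) : MvPolynomial σ R →ₐ[R] MvPolynomial τ R :=
  bind₁ M.toMvPolynomial

theorem linearSubst_X (M : Matrix σ τ R) (i : σ) :
    linearSubst M (X i) = ∑ j, C (M i j) * X j := by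
  simp only [linearSubst, bind₁_X_right, Matrix.toMvPolynomial, C_mul_X_eq_monomial]

theorem linearSubst_C (M : Matrix σ τ R) (c : R) : linearSubst M (C c) = C c :=
  (linearSubst M).commutes c

theorem linearSubst_isHomogeneous (M : Matrix σ τ R) {F : MvPolynomial σ R} {d : ℕ}
    (hF : F.IsHomogeneous d) : (linearSubst M F).IsHomogeneous d := by
  simpa only [one_mul] using! hF.aeval _ M.toMvPolynomial_isHomogeneous

theorem homogeneousComponent_linearSubst (M : Matrix σ τ R) (F : MvPolynomial σ R) (d : ℕ) :
    homogeneousComponent d (linearSubst M F) = linearSubst M (homogeneousComponent d F) := by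
  induction F using MvPolynomial.induction_on' with
  | monomial α c =>
    have hα : (monomial α c).IsHomogeneous α.degree := isHomogeneous_monomial c rfl
    rw [homogeneousComponent_of_mem hα,
      homogeneousComponent_of_mem (linearSubst_isHomogeneous M hα), apply_ite (linearSubst M),
      map_zero]
  | add p q hp hq => simp only [map_add, hp, hq]

theorem linearSubst_one [DecidableEq τ] (F : MvPolynomial τ R) :
    linearSubst (1 : Matrix τ τ R) F = F := by
  rw [linearSubst, Matrix.toMvPolynomial_one, bind₁_X_left, AlgHom.id_apply]

theorem linearSubst_linearSubst [Fintype υ] (M : Matrix σ τ R) (N : Matrix τ υ R)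
    (F : MvPolynomial σ R) : linearSubst N (linearSubst M F) = linearSubst (M * N) F := by
  simp only [linearSubst, bind₁_bind₁, ← Matrix.toMvPolynomial_mul]

theorem eval_linearSubst (M : Matrix σ τ R) (x : τ → R) (F : MvPolynomial σ R) :
    eval x (linearSubst M F) = eval (M.mulVec x) F := by
  rw [linearSubst, eval, eval₂Hom_bind₁]
  congr 2
  exact funext fun i => Matrix.toMvPolynomial_eval_eq_apply M i x

theorem pderiv_linearSubst [Fintype σ] (M : Matrix σ τ R) (j : τ) (F : MvPolynomial σ R) :
    pderiv j (linearSubst M F) = ∑ i, M i j • linearSubst M (pderiv i F) := by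
  classical
  induction F using MvPolynomial.induction_on with
  | C c => simp only [linearSubst_C, pderiv_C, map_zero, smul_zero, Finset.sum_const_zero]
  | add p q hp hq => simp only [map_add, hp, hq, smul_add, Finset.sum_add_distrib]
  | mul_X p k hp =>
    have hX : pderiv j (linearSubst M (X k)) = C (M k j) := by
      rw [linearSubst_X, map_sum, Finset.sum_eq_single j]
      · rw [pderiv_C_mul, pderiv_X_self, mul_one]
      · intro l _ hl
        rw [pderiv_C_mul, pderiv_X_of_ne hl, mul_zero]
      · exact fun h => absurd (Finset.mem_univ j) h
    have hp_k (i : σ) : pderiv i (p * X k) = pderiv i p * X k + if i = k then p else 0 := by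
      rw [pderiv_mul, pderiv_X, Pi.single_apply, mul_ite, mul_one, mul_zero]
      simp only [eq_comm]
    simp only [hp_k, map_mul, map_add, smul_add, Finset.sum_add_distrib, apply_ite (linearSubst M),
      map_zero, smul_ite, smul_zero, Finset.sum_ite_eq', Finset.mem_univ, if_true]
    rw [pderiv_mul, hp, hX, Finset.sum_mul, mul_comm _ (C _), C_mul']
    simp only [smul_mul_assoc]

theorem apolarPairing_linearSubst {𝕜 : Type*} [Field 𝕜] [Fintype σ] (M : Matrix σ τ 𝕜)
    (F : MvPolynomial σ 𝕜) (G : MvPolynomial τ 𝕜) :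
    apolarPairing 𝕜 τ (linearSubst M F) G = apolarPairing 𝕜 σ F (linearSubst M.transpose G) := by
  induction G using MvPolynomial.induction_on generalizing F with
  | C c =>
    have hconst : (linearSubst M F).coeff 0 = F.coeff 0 := by
      simpa only [constantCoeff_eq, eval_zero', eval_zero, Matrix.mulVec_zero]
        using eval_linearSubst M 0 F
    rw [linearSubst_C, C_apply, C_apply, apolarPairing_monomial,
      apolarPairing_monomial, hconst]
    simp only [Finsupp.coe_zero, Pi.zero_apply, Nat.factorial_zero, Nat.cast_one,
      Finset.prod_const_one]
  | add p q hp hq => rw [map_add, map_add, map_add, hp, hq]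
  | mul_X p j hp =>
    rw [mul_comm, apolarPairing_X_mul, pderiv_linearSubst, map_mul, linearSubst_X, Finset.sum_mul,
      map_sum, map_sum, LinearMap.sum_apply]
    refine Finset.sum_congr rfl fun i _ => ?_
    rw [map_smul, LinearMap.smul_apply, hp, mul_assoc, C_mul', map_smul, apolarPairing_X_mul,
      Matrix.transpose_apply]

end LinearSubstitution

section Dehomogenization

variable {R : Type*} [CommSemiring R] {n : ℕ}

/-- The dehomogenization `X_0 ↦ 1`, `X_{i+1} ↦ x_i`. Applied to the divided power expression of `F`
it computes the localization of `F` at `L = X_0`, applied to the coordinate ring of `ℙⁿ` it is the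
restriction to the affine chart centred at the point `(1 : 0 : … : 0)`. -/
noncomputable def dehom (R : Type*) [CommSemiring R] (n : ℕ) :
    MvPolynomial (Fin (n + 1)) R →ₐ[R] MvPolynomial (Fin n) R :=
  aeval (Fin.cons 1 X : Fin (n + 1) → MvPolynomial (Fin n) R)

theorem dehom_X_zero : dehom R n (X 0) = 1 := by
  rw [dehom, aeval_X, Fin.cons_zero]

theorem dehom_X_succ (i : Fin n) : dehom R n (X i.succ) = X i := by
  rw [dehom, aeval_X, Fin.cons_succ]

theorem dehom_C (c : R) : dehom R n (C c) = C c :=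
  (dehom R n).commutes c

theorem degree_eq_add_degree_tail (α : Fin (n + 1) →₀ ℕ) :
    α.degree = α 0 + α.tail.degree := by
  simp only [Finsupp.degree_eq_sum, Fin.sum_univ_succ, Finsupp.tail_apply]

theorem dehom_monomial (α : Fin (n + 1) →₀ ℕ) (c : R) :
    dehom R n (monomial α c) = monomial α.tail c := by
  rw [dehom, aeval_monomial, monomial_eq, Finsupp.prod_fintype _ _ fun _ => pow_zero _,
    Finsupp.prod_fintype _ _ fun _ => pow_zero _, Fin.prod_univ_succ]
  simp only [algebraMap_eq, Fin.cons_zero, one_pow, one_mul, Fin.cons_succ, Finsupp.tail_apply]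

theorem eq_of_degree_eq_of_tail_eq {α β : Fin (n + 1) →₀ ℕ} (hd : α.degree = β.degree)
    (ht : α.tail = β.tail) : α = β := by
  rw [degree_eq_add_degree_tail, degree_eq_add_degree_tail, ht] at hd
  rw [← Finsupp.cons_tail α, ← Finsupp.cons_tail β, ht, Nat.add_right_cancel hd]

theorem coeff_tail_dehom {f : MvPolynomial (Fin (n + 1)) R} {d : ℕ} (hf : f.IsHomogeneous d)
    {α : Fin (n + 1) →₀ ℕ} (hα : α.degree = d) : (dehom R n f).coeff α.tail = f.coeff α := by
  classical
  conv_lhs => rw [f.as_sum, map_sum, coeff_sum]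
  rw [Finset.sum_eq_single α]
  · rw [dehom_monomial, coeff_monomial, if_pos rfl]
  · intro β hβ hne
    have hdeg : β.degree = α.degree := (hf.degree_eq_sum_deg_support hβ).symm.trans hα.symm
    rw [dehom_monomial, coeff_monomial, if_neg fun h => hne (eq_of_degree_eq_of_tail_eq hdeg h)]
  · intro h
    rw [notMem_support_iff.1 h, monomial_zero, map_zero, coeff_zero]

theorem coeff_dehom_eq_zero {f : MvPolynomial (Fin (n + 1)) R} {d : ℕ} (hf : f.IsHomogeneous d)
    {β : Fin n →₀ ℕ} (hβ : d < β.degree) : (dehom R n f).coeff β = 0 := by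
  classical
  rw [f.as_sum, map_sum, coeff_sum]
  refine Finset.sum_eq_zero fun α hα => ?_
  rw [dehom_monomial, coeff_monomial, if_neg]
  rintro rfl
  have hd : d = α.degree := hf.degree_eq_sum_deg_support hα
  have := degree_eq_add_degree_tail α
  omega

theorem dpPairing_dehom {𝕜 : Type*} [Field 𝕜] {f g : MvPolynomial (Fin (n + 1)) 𝕜} {d : ℕ}
    (hf : f.IsHomogeneous d) (hg : g.IsHomogeneous d) :
    dpPairing 𝕜 (Fin n) (dehom 𝕜 n f) (dehom 𝕜 n g) = dpPairing 𝕜 (Fin (n + 1)) f g := by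
  rw [g.as_sum, map_sum, map_sum, map_sum]
  refine Finset.sum_congr rfl fun α hα => ?_
  rw [dehom_monomial, dpPairing_monomial, dpPairing_monomial,
    coeff_tail_dehom hf (hg.degree_eq_sum_deg_support hα).symm]

end Dehomogenization

section Projectivities

variable {𝕜 : Type*} [Field 𝕜] {n : ℕ}

/-- The image of `Z` under the projectivity of `ℙⁿ` given by an invertible matrix `M`, which sends
the point with coordinate vector `y` to the one with coordinate vector `M y`. -/
noncomputable def ProjSubscheme.map (Z : ProjSubscheme 𝕜 n)
    (M : Matrix (Fin (n + 1)) (Fin (n + 1)) 𝕜) (hM : IsUnit M) : ProjSubscheme 𝕜 n where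
  ideal := Z.ideal.comap (linearSubst M)
  homogeneous G hG e := by
    rw [Ideal.mem_comap, ← homogeneousComponent_linearSubst]
    exact Z.homogeneous _ hG e
  saturated G hG := Z.saturated _ fun j => by
    have hX : X j = linearSubst M (∑ i, C (M⁻¹ j i) * X i) := by
      rw [← linearSubst_X, linearSubst_linearSubst,
        Matrix.nonsing_inv_mul _ ((Matrix.isUnit_iff_isUnit_det M).1 hM), linearSubst_one]
    rw [hX, ← map_mul, ← Ideal.mem_comap, Finset.sum_mul]
    refine Ideal.sum_mem _ fun i _ => ?_
    rw [mul_assoc]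
    exact Ideal.mul_mem_left _ _ (hG i)

theorem ProjSubscheme.mem_map {Z : ProjSubscheme 𝕜 n}
    {M : Matrix (Fin (n + 1)) (Fin (n + 1)) 𝕜} {hM : IsUnit M}
    {G : MvPolynomial (Fin (n + 1)) 𝕜} : G ∈ (Z.map M hM).ideal ↔ linearSubst M G ∈ Z.ideal :=
  Iff.rfl

theorem pointIdeal_mulVec_le (M : Matrix (Fin (n + 1)) (Fin (n + 1)) 𝕜) (ℓ : Fin (n + 1) → 𝕜) :
    pointIdeal (M.mulVec ℓ) ≤ (pointIdeal ℓ).comap (linearSubst M) := by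
  refine Ideal.span_le.2 fun G ⟨hG, e, he⟩ => Ideal.subset_span ⟨?_, e, ?_⟩
  · rwa [RingHom.mem_ker, ← eval_linearSubst] at hG
  · exact linearSubst_isHomogeneous M he

theorem ProjSubscheme.pointIdeal_mulVec_pow_le_map {Z : ProjSubscheme 𝕜 n} {ℓ : Fin (n + 1) → 𝕜}
    {t : ℕ} (hZ : pointIdeal ℓ ^ t ≤ Z.ideal) {M : Matrix (Fin (n + 1)) (Fin (n + 1)) 𝕜}
    (hM : IsUnit M) : pointIdeal (M.mulVec ℓ) ^ t ≤ (Z.map M hM).ideal :=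
  calc pointIdeal (M.mulVec ℓ) ^ t
      ≤ (pointIdeal ℓ).comap (linearSubst M) ^ t :=
        Ideal.pow_right_mono (pointIdeal_mulVec_le M ℓ) t
    _ ≤ (pointIdeal ℓ ^ t).comap (linearSubst M) := Ideal.le_comap_pow _ _
    _ ≤ (Z.map M hM).ideal := Ideal.comap_mono hZ

theorem eval_smul_of_isHomogeneous {R σ : Type*} [CommSemiring R]
    {G : MvPolynomial σ R} {e : ℕ} (hG : G.IsHomogeneous e) (c : R) (x : σ → R) :
    eval (c • x) G = c ^ e * eval x G := by
  rw [eval_eq, eval_eq, Finset.mul_sum]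
  refine Finset.sum_congr rfl fun α hα => ?_
  have hdeg : ∑ i ∈ α.support, α i = e := (hG.degree_eq_sum_deg_support hα).symm
  simp only [Pi.smul_apply, smul_eq_mul, mul_pow, Finset.prod_mul_distrib,
    Finset.prod_pow_eq_pow_sum, hdeg]
  ring

theorem pointIdeal_smul {c : 𝕜} (hc : c ≠ 0) (ℓ : Fin (n + 1) → 𝕜) :
    pointIdeal (c • ℓ) = pointIdeal ℓ := by
  rw [pointIdeal, pointIdeal, formsIdeal, formsIdeal]
  congr 1
  ext G
  refine and_congr_left fun ⟨e, he⟩ => ?_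
  rw [RingHom.mem_ker, RingHom.mem_ker, eval_smul_of_isHomogeneous he, mul_eq_zero,
    or_iff_right (pow_ne_zero e hc)]

end Projectivities

section InverseSystem

variable {𝕜 : Type*} [Field 𝕜] {n : ℕ}

/-- The degree `d` part of the Macaulay inverse system of `I(Z)`: the forms of degree `d` that are
orthogonal to `I(Z)` for the apolarity pairing. -/
noncomputable def ProjSubscheme.inverseSystem (Z : ProjSubscheme 𝕜 n) (d : ℕ) :
    Submodule 𝕜 (MvPolynomial (Fin (n + 1)) 𝕜) :=
  homogeneousSubmodule (Fin (n + 1)) 𝕜 d ⊓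
    (Z.ideal.restrictScalars 𝕜).dualAnnihilator.comap (apolarPairing 𝕜 (Fin (n + 1)))

theorem ProjSubscheme.mem_inverseSystem {Z : ProjSubscheme 𝕜 n} {d : ℕ}
    {F : MvPolynomial (Fin (n + 1)) 𝕜} :
    F ∈ Z.inverseSystem d ↔
      F.IsHomogeneous d ∧ ∀ H ∈ Z.ideal, apolarPairing 𝕜 (Fin (n + 1)) F H = 0 := by
  rw [inverseSystem, Submodule.mem_inf, mem_homogeneousSubmodule, Submodule.mem_comap,
    Submodule.mem_dualAnnihilator]
  rfl

theorem ProjSubscheme.IsApolar.mem_inverseSystem {Z : ProjSubscheme 𝕜 n} {d : ℕ}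
    {F : MvPolynomial (Fin (n + 1)) 𝕜} (hZ : Z.IsApolar F) (hF : F.IsHomogeneous d) :
    F ∈ Z.inverseSystem d :=
  ProjSubscheme.mem_inverseSystem.2 ⟨hF, fun H hH => by
    rw [← coeff_zero_diffAct, hZ H hH, coeff_zero]⟩

theorem ProjSubscheme.linearSubst_transpose_mem_inverseSystem_map {Z : ProjSubscheme 𝕜 n} {d : ℕ}
    {F : MvPolynomial (Fin (n + 1)) 𝕜} (hF : F ∈ Z.inverseSystem d)
    {M : Matrix (Fin (n + 1)) (Fin (n + 1)) 𝕜} (hM : IsUnit M) :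
    linearSubst M.transpose F ∈ (Z.map M hM).inverseSystem d := by
  rw [mem_inverseSystem] at hF ⊢
  refine ⟨linearSubst_isHomogeneous _ hF.1, fun H hH => ?_⟩
  rw [apolarPairing_linearSubst, Matrix.transpose_transpose]
  exact hF.2 _ (mem_map.1 hH)

theorem ProjSubscheme.inverseSystem_anti {Z W : ProjSubscheme 𝕜 n} (h : Z.Contains W) (d : ℕ) :
    W.inverseSystem d ≤ Z.inverseSystem d := fun _ hF =>
  ProjSubscheme.mem_inverseSystem.2
    ⟨(mem_inverseSystem.1 hF).1, fun H hH => (mem_inverseSystem.1 hF).2 H (h hH)⟩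

theorem ProjSubscheme.inverseSystem_union {ι : Type*} [Finite ι] (W : ι → ProjSubscheme 𝕜 n)
    {d : ℕ} (hd : (d.factorial : 𝕜) ≠ 0) :
    (ProjSubscheme.union W).inverseSystem d = ⨆ i, (W i).inverseSystem d := by
  refine le_antisymm (fun F hF => ?_) (iSup_le fun i => inverseSystem_anti (iInf_le _ i) d)
  obtain ⟨hFd, hFW⟩ := mem_inverseSystem.1 hF
  have hmem : apolarPairing 𝕜 (Fin (n + 1)) F ∈
      ⨆ i, ((W i).ideal.restrictScalars 𝕜).dualAnnihilator := by
    rw [← Subspace.dualAnnihilator_iInf_eq, Submodule.mem_dualAnnihilator]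
    refine fun H hH => hFW H ?_
    simpa only [ProjSubscheme.union, Ideal.mem_iInf, Submodule.mem_iInf,
      Submodule.restrictScalars_mem] using hH
  obtain ⟨φ, hφ, hsum⟩ := (Submodule.mem_iSup_iff_exists_finsupp _ _).1 hmem
  choose f hf hfφ using fun i => exists_form_apolarPairing_eq hd (φ i)
  have hfW (i : ι) : f i ∈ (W i).inverseSystem d := mem_inverseSystem.2 ⟨hf i, fun H hH => by
    rw [hfφ]
    exact (Submodule.mem_dualAnnihilator _).1 (hφ i) _ ((W i).homogeneous H hH d)⟩
  have hF_eq : F = ∑ i ∈ φ.support, f i := by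
    refine eq_of_apolarPairing_eq hd hFd (IsHomogeneous.sum _ _ _ fun i _ => hf i) fun H hH => ?_
    rw [← hsum, Finsupp.sum, map_sum, LinearMap.sum_apply, LinearMap.sum_apply]
    refine Finset.sum_congr rfl fun i _ => ?_
    rw [hfφ, homogeneousComponent_of_mem hH, if_pos rfl]
  rw [hF_eq]
  exact Submodule.sum_mem _ fun i _ => Submodule.mem_iSup_of_mem i (hfW i)

end InverseSystem

theorem divMonomial_isHomogeneous {R σ : Type*} [CommSemiring R] {a : σ →₀ ℕ} {d : ℕ}
    {H : MvPolynomial σ R} (hH : H.IsHomogeneous (a.degree + d)) :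
    (H.divMonomial a).IsHomogeneous d := by
  intro γ hγ
  rw [coeff_divMonomial] at hγ
  have hdeg : (a + γ).degree = a.degree + d := by_contra fun h => hγ (hH.coeff_eq_zero h)
  rw [map_add] at hdeg
  exact (DFunLike.congr_fun Finsupp.degree_eq_weight_one γ).symm.trans (Nat.add_left_cancel hdeg)

section StandardPoint

variable {𝕜 : Type*} [Field 𝕜] {n : ℕ} {Z : ProjSubscheme 𝕜 n}

theorem X_succ_mem_pointIdeal_single (i : Fin n) :
    X i.succ ∈ pointIdeal (Pi.single 0 1 : Fin (n + 1) → 𝕜) :=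
  Ideal.subset_span ⟨by
    rw [RingHom.mem_ker, eval_X, Pi.single_eq_of_ne i.succ_ne_zero], 1,
    isHomogeneous_X 𝕜 _⟩

theorem monomial_mem_of_le_degree_tail {I : Ideal (MvPolynomial (Fin (n + 1)) 𝕜)} {t : ℕ}
    (hI : pointIdeal (Pi.single 0 1) ^ t ≤ I) {α : Fin (n + 1) →₀ ℕ} (hα : t ≤ α.tail.degree)
    (c : 𝕜) : monomial α c ∈ I := by
  refine hI (Ideal.pow_le_pow_right hα ?_)
  rw [monomial_eq, Finsupp.prod_fintype _ _ fun _ => pow_zero _, Fin.prod_univ_succ, ← mul_assoc,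
    Finsupp.degree_eq_sum, ← Finset.prod_pow_eq_pow_sum]
  exact Ideal.mul_mem_left _ _ (Ideal.prod_mem_prod fun i _ =>
    Ideal.pow_mem_pow (X_succ_mem_pointIdeal_single i) _)

theorem mem_of_X_zero_mul_mem {t : ℕ} (hZ : pointIdeal (Pi.single 0 1) ^ t ≤ Z.ideal)
    {H : MvPolynomial (Fin (n + 1)) 𝕜} (hH : X 0 * H ∈ Z.ideal) : H ∈ Z.ideal := by
  suffices h : ∀ u, (∀ P ∈ pointIdeal (Pi.single 0 1 : Fin (n + 1) → 𝕜) ^ u, P * H ∈ Z.ideal) →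
      H ∈ Z.ideal from h t fun P hP => Z.ideal.mul_mem_right H (hZ hP)
  intro u
  induction u with
  | zero =>
    intro h
    rw [pow_zero, Ideal.one_eq_top] at h
    simpa only [one_mul] using h 1 Submodule.mem_top
  | succ u ih =>
    refine fun h => ih fun P hP => Z.saturated _ fun i => ?_
    cases i using Fin.cases with
    | zero =>
      rw [mul_left_comm]
      exact Z.ideal.mul_mem_left P hH
    | succ i =>
      rw [← mul_assoc]
      refine h _ ?_
      rw [pow_succ']
      exact Ideal.mul_mem_mul (X_succ_mem_pointIdeal_single i) hP

theorem mem_of_X_zero_pow_mul_mem {t : ℕ} (hZ : pointIdeal (Pi.single 0 1) ^ t ≤ Z.ideal) (N : ℕ)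
    {H : MvPolynomial (Fin (n + 1)) 𝕜} (hH : X 0 ^ N * H ∈ Z.ideal) : H ∈ Z.ideal := by
  induction N with
  | zero => rwa [pow_zero, one_mul] at hH
  | succ N ih => exact ih (mem_of_X_zero_mul_mem hZ (by rwa [← mul_assoc, ← pow_succ']))

theorem X_zero_pow_dvd_of_mem_inverseSystem {d k : ℕ} (hd : (d.factorial : 𝕜) ≠ 0)
    (hZ : pointIdeal (Pi.single 0 1) ^ (k + 1) ≤ Z.ideal) {F : MvPolynomial (Fin (n + 1)) 𝕜}
    (hF : F ∈ Z.inverseSystem d) : X 0 ^ (d - k) ∣ F := by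
  obtain ⟨hFd, hFZ⟩ := ProjSubscheme.mem_inverseSystem.1 hF
  rw [F.as_sum]
  refine Finset.dvd_sum fun α hα => ?_
  rw [X_pow_eq_monomial, monomial_dvd_monomial]
  refine ⟨Or.inr (Finsupp.single_le_iff.2 ?_), one_dvd _⟩
  by_contra hlt
  have hαd : α.degree = d := (hFd.degree_eq_sum_deg_support hα).symm
  have htail := degree_eq_add_degree_tail α
  have hpair := hFZ _ (monomial_mem_of_le_degree_tail hZ (show k + 1 ≤ α.tail.degree by omega) 1)
  rw [apolarPairing_monomial, one_mul] at hpair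
  exact mem_support_iff.1 hα
    ((mul_eq_zero.1 hpair).resolve_right (prod_cast_factorial_ne_zero (hαd ▸ hd)))

theorem dpPairing_dehom_eq_zero_of_isHomogeneous {d k m : ℕ} (hk : k ≤ d)
    (hZ : pointIdeal (Pi.single 0 1) ^ (k + 1) ≤ Z.ideal) {F H : MvPolynomial (Fin (n + 1)) 𝕜}
    (hF : F ∈ Z.inverseSystem d) (hH : H ∈ Z.ideal) (hHd : H.IsHomogeneous (m + d)) :
    dpPairing 𝕜 (Fin n) (dehom 𝕜 n (toDP F)) (dehom 𝕜 n H) = 0 := by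
  obtain ⟨hFd, hFZ⟩ := ProjSubscheme.mem_inverseSystem.1 hF
  set Q := H.divMonomial (Finsupp.single 0 m) with hQ
  set r := H.modMonomial (Finsupp.single 0 m) with hr
  have hdecomp : H = X 0 ^ m * Q + r := by
    rw [X_pow_eq_monomial, hQ, hr, divMonomial_add_modMonomial]
  have hr_tail : ∀ α ∈ r.support, d < α.tail.degree := by
    intro α hα
    have hα0 : α 0 < m := by
      by_contra! hle
      exact mem_support_iff.1 hα (coeff_modMonomial_of_le H (Finsupp.single_le_iff.2 hle))
    have hαH : α ∈ H.support := by
      rw [mem_support_iff] at hα ⊢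
      rwa [hr, coeff_modMonomial_of_not_le H (by rwa [Finsupp.single_le_iff, not_le])] at hα
    have hdeg : m + d = α.degree := hHd.degree_eq_sum_deg_support hαH
    rw [degree_eq_add_degree_tail] at hdeg
    omega
  have hr_mem : r ∈ Z.ideal := by
    rw [r.as_sum]
    exact Ideal.sum_mem _ fun α hα =>
      monomial_mem_of_le_degree_tail hZ (hk.trans_lt (hr_tail α hα)) _
  have hr_pairing : dpPairing 𝕜 (Fin n) (dehom 𝕜 n (toDP F)) (dehom 𝕜 n r) = 0 := by
    rw [r.as_sum, map_sum, map_sum]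
    refine Finset.sum_eq_zero fun α hα => ?_
    rw [dehom_monomial, dpPairing_monomial,
      coeff_dehom_eq_zero (toDP_isHomogeneous hFd) (hr_tail α hα), mul_zero]
  have hQ_mem : Q ∈ Z.ideal := by
    refine mem_of_X_zero_pow_mul_mem hZ m ((Ideal.add_mem_iff_left _ hr_mem).1 ?_)
    rwa [← hdecomp]
  have hQ_hom : Q.IsHomogeneous d :=
    divMonomial_isHomogeneous (by rwa [Finsupp.degree_single])
  rw [hdecomp, map_add, map_mul, map_pow, dehom_X_zero, one_pow, one_mul, map_add, hr_pairing,
    add_zero, dpPairing_dehom (toDP_isHomogeneous hFd) hQ_hom]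
  exact hFZ Q hQ_mem

theorem dpPairing_dehom_eq_zero {d k : ℕ} (hk : k ≤ d)
    (hZ : pointIdeal (Pi.single 0 1) ^ (k + 1) ≤ Z.ideal) {F H : MvPolynomial (Fin (n + 1)) 𝕜}
    (hF : F ∈ Z.inverseSystem d) (hH : H ∈ Z.ideal) :
    dpPairing 𝕜 (Fin n) (dehom 𝕜 n (toDP F)) (dehom 𝕜 n H) = 0 := by
  rw [← sum_homogeneousComponent H, map_sum, map_sum]
  refine Finset.sum_eq_zero fun e _ => ?_
  have hdehom : dehom 𝕜 n (homogeneousComponent e H)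
      = dehom 𝕜 n (homogeneousComponent e H * X 0 ^ d) := by
    rw [map_mul, map_pow, dehom_X_zero, one_pow, mul_one]
  rw [hdehom]
  refine dpPairing_dehom_eq_zero_of_isHomogeneous hk hZ hF
    (Z.ideal.mul_mem_right _ (Z.homogeneous H hH e))
    ((homogeneousComponent_isHomogeneous e H).mul ?_)
  simpa only [one_mul] using (isHomogeneous_X 𝕜 (0 : Fin (n + 1))).pow d

theorem ideal_le_comap_dehom_contractAnn {d k : ℕ} (hk : k ≤ d)
    (hZ : pointIdeal (Pi.single 0 1) ^ (k + 1) ≤ Z.ideal) {F : MvPolynomial (Fin (n + 1)) 𝕜}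
    (hF : F ∈ Z.inverseSystem d) :
    Z.ideal ≤ (contractAnn (dehom 𝕜 n (toDP F))).comap (dehom 𝕜 n) := by
  intro H hH
  change contract (dehom 𝕜 n H) (dehom 𝕜 n (toDP F)) = 0
  ext γ
  have hγ : monomial γ 1 = dehom 𝕜 n (monomial (γ.cons 0) 1) := by
    rw [dehom_monomial, Finsupp.tail_cons]
  rw [coeff_contract, hγ, ← map_mul,
    dpPairing_dehom_eq_zero hk hZ hF (Z.ideal.mul_mem_left _ hH), coeff_zero]

end StandardPoint

section Coordinates

variable {𝕜 : Type*} [Field 𝕜] {n : ℕ} {ℓ : Fin (n + 1) → 𝕜} {j : Fin (n + 1)}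

/-- The matrix whose rows are the coefficient vectors of the basis of `S_1` that consists of `L` and
the variables `X_{j.succAbove i}`. -/
noncomputable def basisMatrix (ℓ : Fin (n + 1) → 𝕜) (j : Fin (n + 1)) :
    Matrix (Fin (n + 1)) (Fin (n + 1)) 𝕜 :=
  Matrix.of (Fin.cons ℓ fun i => Pi.single (j.succAbove i) 1)

theorem basisMatrix_zero (m : Fin (n + 1)) : basisMatrix ℓ j 0 m = ℓ m :=
  rfl

theorem basisMatrix_succ (i : Fin n) (m : Fin (n + 1)) :
    basisMatrix ℓ j i.succ m = (Pi.single (j.succAbove i) 1 : Fin (n + 1) → 𝕜) m :=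
  rfl

theorem isUnit_basisMatrix (hj : ℓ j ≠ 0) : IsUnit (basisMatrix ℓ j) := by
  rw [← Matrix.mulVec_injective_iff_isUnit]
  refine (injective_iff_map_eq_zero (basisMatrix ℓ j).mulVecLin).2 fun v hv => ?_
  have hv_succAbove (i : Fin n) : v (j.succAbove i) = 0 := by
    rw [← single_one_dotProduct (j.succAbove i) v]
    exact congrFun hv i.succ
  have hv_j : ℓ j * v j = 0 := by
    have h0 : ∑ m, ℓ m * v m = 0 := congrFun hv 0
    simpa only [Fin.sum_univ_succAbove _ j, hv_succAbove, mul_zero, Finset.sum_const_zero,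
      add_zero] using h0
  funext m
  cases m using j.succAboveCases with
  | x => exact (mul_eq_zero.1 hv_j).resolve_left hj
  | p i => exact hv_succAbove i

theorem linearSubst_basisMatrix_X_zero : linearSubst (basisMatrix ℓ j) (X 0) = linearForm ℓ :=
  linearSubst_X _ _

theorem linearSubst_basisMatrix_X_succ (i : Fin n) :
    linearSubst (basisMatrix ℓ j) (X i.succ) = X (j.succAbove i) := by
  rw [linearSubst_X, Finset.sum_eq_single (j.succAbove i)]
  · rw [basisMatrix_succ, Pi.single_eq_same, C_1, one_mul]
  · intro m _ hm
    rw [basisMatrix_succ, Pi.single_eq_of_ne hm, C_0, zero_mul]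
  · exact fun h => absurd (Finset.mem_univ _) h

theorem linearSubst_basisMatrix_changeCoords (hj : ℓ j ≠ 0) (F : MvPolynomial (Fin (n + 1)) 𝕜) :
    linearSubst (basisMatrix ℓ j) (changeCoords ℓ j F) = F := by
  suffices h : (linearSubst (basisMatrix ℓ j)).comp (changeCoords ℓ j) = AlgHom.id 𝕜 _ from
    DFunLike.congr_fun h F
  refine algHom_ext fun m => ?_
  rw [AlgHom.comp_apply, AlgHom.id_apply, changeCoords, aeval_X]
  cases m using j.succAboveCases with
  | x =>
    simp only [Fin.insertNth_apply_same, map_mul, map_sub, map_sum,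
      linearSubst_basisMatrix_X_zero, linearSubst_basisMatrix_X_succ, linearSubst_C, linearForm,
      Fin.sum_univ_succAbove _ j, add_sub_cancel_right]
    rw [← mul_assoc, ← C_mul, inv_mul_cancel₀ hj, C_1, one_mul]
  | p i => rw [Fin.insertNth_apply_succAbove, linearSubst_basisMatrix_X_succ]

theorem changeCoords_eq_linearSubst (hj : ℓ j ≠ 0) (F : MvPolynomial (Fin (n + 1)) 𝕜) :
    changeCoords ℓ j F = linearSubst (basisMatrix ℓ j)⁻¹ F := by
  conv_rhs => rw [← linearSubst_basisMatrix_changeCoords hj F]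
  rw [linearSubst_linearSubst, Matrix.mul_nonsing_inv _
    ((Matrix.isUnit_iff_isUnit_det _).1 (isUnit_basisMatrix hj)), linearSubst_one]

theorem localization_eq_dehom (F : MvPolynomial (Fin (n + 1)) 𝕜) :
    localization F ℓ j = dehom 𝕜 n (toDP (changeCoords ℓ j F)) :=
  rfl

theorem dehom_linearSubst_basisMatrix_transpose (H : MvPolynomial (Fin (n + 1)) 𝕜) :
    dehom 𝕜 n (linearSubst (basisMatrix ℓ j).transpose H) = chart ℓ j H := by
  suffices h : (dehom 𝕜 n).comp (linearSubst (basisMatrix ℓ j).transpose) = chart ℓ j from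
    DFunLike.congr_fun h H
  refine algHom_ext fun m => ?_
  rw [AlgHom.comp_apply, linearSubst_X, chart, aeval_X, Fin.sum_univ_succ, map_add, map_sum]
  simp only [map_mul, dehom_X_zero, dehom_X_succ, dehom_C, Matrix.transpose_apply, mul_one,
    basisMatrix_zero, basisMatrix_succ]
  congr 1
  cases m using j.succAboveCases with
  | x =>
    rw [Fin.insertNth_apply_same]
    refine Finset.sum_eq_zero fun i _ => ?_
    rw [Pi.single_eq_of_ne (Fin.succAbove_ne j i).symm, C_0, zero_mul]
  | p l =>
    rw [Fin.insertNth_apply_succAbove, Finset.sum_eq_single l]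
    · rw [Pi.single_eq_same, C_1, one_mul]
    · intro i _ hi
      rw [Pi.single_eq_of_ne (Fin.succAbove_right_injective.ne hi.symm), C_0, zero_mul]
    · exact fun h => absurd (Finset.mem_univ l) h

theorem isUnit_inv_basisMatrix_transpose (hj : ℓ j ≠ 0) :
    IsUnit (basisMatrix ℓ j)⁻¹.transpose :=
  (Matrix.isUnit_transpose _).2 (Matrix.isUnit_nonsing_inv_iff.2 (isUnit_basisMatrix hj))

theorem inv_basisMatrix_transpose_mulVec (hj : ℓ j ≠ 0) :
    (basisMatrix ℓ j)⁻¹.transpose.mulVec ℓ = Pi.single 0 1 := by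
  have hℓ : (basisMatrix ℓ j).transpose.mulVec (Pi.single 0 1) = ℓ := by
    rw [Matrix.mulVec_single_one]
    rfl
  calc (basisMatrix ℓ j)⁻¹.transpose.mulVec ℓ
      = (basisMatrix ℓ j)⁻¹.transpose.mulVec
          ((basisMatrix ℓ j).transpose.mulVec (Pi.single 0 1)) := by rw [hℓ]
    _ = Pi.single 0 1 := by
      rw [Matrix.mulVec_mulVec, ← Matrix.transpose_mul, Matrix.mul_nonsing_inv _
        ((Matrix.isUnit_iff_isUnit_det _).1 (isUnit_basisMatrix hj)), Matrix.transpose_one,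
        Matrix.one_mulVec]

end Coordinates

section LocalScheme

variable {𝕜 : Type*} [Field 𝕜] {n d k : ℕ} {ℓ : Fin (n + 1) → 𝕜} {j : Fin (n + 1)}
  {Z : ProjSubscheme 𝕜 n} {F : MvPolynomial (Fin (n + 1)) 𝕜}

theorem pointIdeal_single_pow_le_map (hj : ℓ j ≠ 0) {t : ℕ} (hZ : pointIdeal ℓ ^ t ≤ Z.ideal) :
    pointIdeal (Pi.single 0 1) ^ t ≤ (Z.map _ (isUnit_inv_basisMatrix_transpose hj)).ideal := by
  rw [← inv_basisMatrix_transpose_mulVec hj]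
  exact ProjSubscheme.pointIdeal_mulVec_pow_le_map hZ _

theorem changeCoords_mem_inverseSystem_map (hj : ℓ j ≠ 0) (hF : F ∈ Z.inverseSystem d) :
    changeCoords ℓ j F ∈
      (Z.map _ (isUnit_inv_basisMatrix_transpose hj)).inverseSystem d := by
  rw [changeCoords_eq_linearSubst hj]
  exact ProjSubscheme.linearSubst_transpose_mem_inverseSystem_map hF _

theorem ideal_le_comap_chart_contractAnn (hj : ℓ j ≠ 0) (hk : k ≤ d)
    (hZ : pointIdeal ℓ ^ (k + 1) ≤ Z.ideal) (hF : F ∈ Z.inverseSystem d) :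
    Z.ideal ≤ (contractAnn (localization F ℓ j)).comap (chart ℓ j) := by
  intro H hH
  have hmem : linearSubst (basisMatrix ℓ j).transpose H ∈
      (Z.map _ (isUnit_inv_basisMatrix_transpose hj)).ideal := by
    rwa [ProjSubscheme.mem_map, linearSubst_linearSubst, ← Matrix.transpose_mul,
      Matrix.nonsing_inv_mul _ ((Matrix.isUnit_iff_isUnit_det _).1 (isUnit_basisMatrix hj)),
      Matrix.transpose_one, linearSubst_one]
  rw [Ideal.mem_comap, localization_eq_dehom, ← dehom_linearSubst_basisMatrix_transpose]
  exact ideal_le_comap_dehom_contractAnn hk (pointIdeal_single_pow_le_map hj hZ)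
    (changeCoords_mem_inverseSystem_map hj hF) hmem

theorem ProjSubscheme.contains_naturalApolarScheme (hℓ : ℓ ≠ 0) (hk : k ≤ d)
    (hZ : pointIdeal ℓ ^ (k + 1) ≤ Z.ideal) (hF : F ∈ Z.inverseSystem d) :
    Z.Contains (naturalApolarScheme F ℓ hℓ) := by
  intro H hH
  rw [← sum_homogeneousComponent H]
  exact Ideal.sum_mem _ fun e _ => Ideal.subset_span
    ⟨ideal_le_comap_chart_contractAnn (Classical.choose_spec (Function.ne_iff.1 hℓ)) hk hZ hF
      (Z.homogeneous H hH e), e, homogeneousComponent_isHomogeneous e H⟩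

theorem linearForm_pow_dvd_of_mem_inverseSystem (hℓ : ℓ ≠ 0) (hd : (d.factorial : 𝕜) ≠ 0)
    (hZ : pointIdeal ℓ ^ (k + 1) ≤ Z.ideal) (hF : F ∈ Z.inverseSystem d) :
    linearForm ℓ ^ (d - k) ∣ F := by
  obtain ⟨j, hj⟩ := Function.ne_iff.1 hℓ
  have hdvd : X 0 ^ (d - k) ∣ changeCoords ℓ j F :=
    X_zero_pow_dvd_of_mem_inverseSystem hd (pointIdeal_single_pow_le_map hj hZ)
      (changeCoords_mem_inverseSystem_map hj hF)
  simpa only [map_pow, linearSubst_basisMatrix_X_zero, linearSubst_basisMatrix_changeCoords hj]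
    using map_dvd (linearSubst (basisMatrix ℓ j)) hdvd

end LocalScheme

section Factorization

variable {R σ : Type*} [CommRing R]

theorem homogeneousComponent_mul_of_isHomogeneous {P : MvPolynomial σ R} {m : ℕ}
    (hP : P.IsHomogeneous m) (G : MvPolynomial σ R) (k : ℕ) :
    homogeneousComponent (m + k) (P * G) = P * homogeneousComponent k G := by
  let _ := gradedAlgebra (σ := σ) (R := R)
  simpa only [DirectSum.decompose, Equiv.coe_fn_mk, decomposition.decompose'_apply] using
    DirectSum.coe_decompose_mul_add_of_left_mem (homogeneousSubmodule σ R) (b := G) (j := k) hP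

variable [IsDomain R]

theorem isHomogeneous_of_mul_left {P G : MvPolynomial σ R} {m k : ℕ} (hP : P.IsHomogeneous m)
    (hP0 : P ≠ 0) (hPG : (P * G).IsHomogeneous (m + k)) : G.IsHomogeneous k := by
  have hG : homogeneousComponent k G = G := mul_left_cancel₀ hP0 <| by
    rw [← homogeneousComponent_mul_of_isHomogeneous hP, homogeneousComponent_eq_self hPG]
  exact hG ▸ homogeneousComponent_isHomogeneous k G

theorem le_of_pow_dvd_of_isHomogeneous {P F : MvPolynomial σ R} {d e : ℕ}
    (hP : P.IsHomogeneous 1) (hF : F.IsHomogeneous d) (hF0 : F ≠ 0) (h : P ^ e ∣ F) : e ≤ d := by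
  have hPe : P ^ e ≠ 0 := ne_zero_of_dvd_ne_zero hF0 h
  have hdeg := totalDegree_le_of_dvd_of_isDomain h hF0
  rwa [(hP.pow e).totalDegree hPe, hF.totalDegree hF0, one_mul] at hdeg

theorem exists_eq_pow_mul_and_not_dvd_of_isHomogeneous {P F : MvPolynomial σ R} {d t : ℕ}
    (hP : P.IsHomogeneous 1) (hF : F.IsHomogeneous d) (hF0 : F ≠ 0) (hdvd : P ^ (d - t) ∣ F) :
    ∃ k ≤ t, ∃ G : MvPolynomial σ R, G.IsHomogeneous k ∧ ¬ P ∣ G ∧ F = P ^ (d - k) * G := by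
  have hfin : FiniteMultiplicity P F := ⟨d, fun h =>
    (le_of_pow_dvd_of_isHomogeneous hP hF hF0 h).not_gt d.lt_succ_self⟩
  obtain ⟨G, hFG, hndvd⟩ := hfin.exists_eq_pow_mul_and_not_dvd
  have hle : multiplicity P F ≤ d :=
    le_of_pow_dvd_of_isHomogeneous hP hF hF0 (pow_multiplicity_dvd P F)
  have hge : d - t ≤ multiplicity P F := hfin.le_multiplicity_of_pow_dvd hdvd
  refine ⟨d - multiplicity P F, by omega, G, ?_, hndvd, by rwa [Nat.sub_sub_self hle]⟩
  have hPm := hP.pow (multiplicity P F)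
  rw [one_mul] at hPm
  refine isHomogeneous_of_mul_left hPm (ne_zero_of_dvd_ne_zero hF0 (pow_multiplicity_dvd P F)) ?_
  rwa [← hFG, Nat.add_sub_cancel' hle]

end Factorization

section LinearForm

variable {𝕜 : Type*} [Field 𝕜] {n : ℕ}

theorem linearForm_isHomogeneous (ℓ : Fin (n + 1) → 𝕜) : (linearForm ℓ).IsHomogeneous 1 :=
  IsHomogeneous.sum _ _ _ fun m _ => isHomogeneous_C_mul_X (ℓ m) m

theorem ProjSubscheme.exists_eq_linearForm_pow_mul {Z : ProjSubscheme 𝕜 n} {d t : ℕ}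
    {ℓ : Fin (n + 1) → 𝕜} (hℓ : ℓ ≠ 0) (hd : (d.factorial : 𝕜) ≠ 0)
    (hZ : pointIdeal ℓ ^ (t + 1) ≤ Z.ideal) {F : MvPolynomial (Fin (n + 1)) 𝕜}
    (hF : F ∈ Z.inverseSystem d) (hF0 : F ≠ 0) :
    ∃ k ≤ t, ∃ G : MvPolynomial (Fin (n + 1)) 𝕜,
      G.IsHomogeneous k ∧ ¬ linearForm ℓ ∣ G ∧ F = linearForm ℓ ^ (d - k) * G :=
  exists_eq_pow_mul_and_not_dvd_of_isHomogeneous (linearForm_isHomogeneous ℓ)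
    (mem_inverseSystem.1 hF).1 hF0 (linearForm_pow_dvd_of_mem_inverseSystem hℓ hd hZ hF)

end LinearForm

section Decomposition

variable {𝕜 : Type*} [Field 𝕜] {n d : ℕ} {ι : Type*}

theorem exists_GAD_of_sum_eq [Fintype ι] (hd : (d.factorial : 𝕜) ≠ 0)
    {L : ι → Fin (n + 1) → 𝕜} (hL : ∀ i, L i ≠ 0) {t : ι → ℕ} (ht : ∀ i, t i ≤ d)
    {W : ι → ProjSubscheme 𝕜 n} (hW : ∀ i, pointIdeal (L i) ^ (t i + 1) ≤ (W i).ideal)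
    {f : ι → MvPolynomial (Fin (n + 1)) 𝕜} (hf : ∀ i, f i ∈ (W i).inverseSystem d)
    (hinj : Set.InjOn (fun i => pointIdeal (L i)) {i | f i ≠ 0})
    {F : MvPolynomial (Fin (n + 1)) 𝕜} (hF : ∑ i, f i = F) :
    ∃ (J : Finset ι) (D : GAD d F J), (∀ i : J, D.L i = L i) ∧ (∀ i : J, D.k i ≤ t i) ∧
      (ProjSubscheme.union W).Contains D.scheme := by
  classical
  set J : Finset ι := Finset.univ.filter fun i => f i ≠ 0
  have hJ (i : J) : f i ≠ 0 := (Finset.mem_filter.1 i.2).2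
  choose k hk G hG hndvd hfG using fun i : J =>
    ProjSubscheme.exists_eq_linearForm_pow_mul (hL i) hd (hW i) (hf i) (hJ i)
  have hprop (i i' : J) (hne : i ≠ i') (c : 𝕜) : L i ≠ c • L i' := by
    intro hc
    have hc0 : c ≠ 0 := by
      rintro rfl
      exact hL i (by rw [hc, zero_smul])
    have hpoint : pointIdeal (L i) = pointIdeal (L i') := by rw [hc, pointIdeal_smul hc0]
    exact hne (Subtype.ext (hinj (hJ i) (hJ i') hpoint))
  have hsum : F = ∑ i : J, linearForm (L i) ^ (d - k i) * G i :=
    calc F = ∑ i ∈ J, f i := by rw [← hF, Finset.sum_filter_ne_zero]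
      _ = ∑ i : J, f i := (Finset.sum_coe_sort J f).symm
      _ = _ := Finset.sum_congr rfl fun i _ => hfG i
  refine ⟨J, ⟨fun i => L i, fun i => hL i, hprop, k, fun i => (hk i).trans (ht i), G, hG, hndvd,
    hsum⟩, fun _ => rfl, hk, le_iInf fun i => (iInf_le _ i.1).trans ?_⟩
  simp only [← hfG i]
  exact ProjSubscheme.contains_naturalApolarScheme (hL i) (ht i) (hW i) (hf i)

theorem exists_representative_max {β γ : Type*} [Finite ι] [LinearOrder γ] (p : ι → β)
    (κ : ι → γ) :
    ∃ r : ι → ι, (∀ i, p (r i) = p i) ∧ (∀ i, κ i ≤ κ (r i)) ∧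
      ∀ i i', p i = p i' → r i = r i' := by
  have hmax (b : Set.range p) : ∃ i, p i = b ∧ ∀ i', p i' = b → κ i' ≤ κ i := by
    obtain ⟨_, i, rfl⟩ := b
    exact Set.exists_max_image {i' | p i' = p i} κ (Set.toFinite _) ⟨i, rfl⟩
  choose g hg hgmax using hmax
  exact ⟨fun i => g ⟨p i, i, rfl⟩, fun i => hg _, fun i => hgmax _ i rfl,
    fun i i' h => by simp only [h]⟩

theorem ProjSubscheme.union_fiberwise {κ : Type*} (W : ι → ProjSubscheme 𝕜 n) (r : ι → κ) :
    (ProjSubscheme.union fun c => ProjSubscheme.union fun i : {i // r i = c} => W i) =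
      ProjSubscheme.union W := by
  ext G
  simp only [ProjSubscheme.union, Ideal.mem_iInf]
  exact ⟨fun h i => h (r i) ⟨i, rfl⟩, fun h c i => h i⟩

theorem ProjSubscheme.exists_union_eq_and_injOn_pointIdeal [Finite ι] (L : ι → Fin (n + 1) → 𝕜)
    (t : ι → ℕ) {W : ι → ProjSubscheme 𝕜 n}
    (hW : ∀ i, pointIdeal (L i) ^ (t i + 1) ≤ (W i).ideal) :
    ∃ V : ι → ProjSubscheme 𝕜 n, ProjSubscheme.union V = ProjSubscheme.union W ∧
      (∀ i, pointIdeal (L i) ^ (t i + 1) ≤ (V i).ideal) ∧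
      Set.InjOn (fun i => pointIdeal (L i)) {i | (V i).ideal ≠ ⊤} := by
  obtain ⟨r, hr_point, hr_le, hr_eq⟩ := exists_representative_max (fun i => pointIdeal (L i)) t
  have hr_fixed : ∀ c, (⨅ i : {i // r i = c}, (W i).ideal) ≠ ⊤ → r c = c := by
    intro c hc
    by_contra hne
    have : IsEmpty {i // r i = c} :=
      ⟨fun ⟨i, hi⟩ => hne ((congrArg r hi).symm.trans ((hr_eq _ _ (hr_point i)).trans hi))⟩
    exact hc (iInf_of_empty _)
  refine ⟨fun c => ProjSubscheme.union fun i : {i // r i = c} => W i, union_fiberwise W r,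
    fun c => le_iInf ?_, fun c hc c' hc' h => ?_⟩
  · rintro ⟨i, rfl⟩
    rw [hr_point i]
    exact (Ideal.pow_le_pow_right (Nat.succ_le_succ (hr_le i))).trans (hW i)
  · rw [← hr_fixed c hc, ← hr_fixed c' hc', hr_eq c c' h]

theorem ProjSubscheme.inverseSystem_eq_bot {Z : ProjSubscheme 𝕜 n} (hZ : Z.ideal = ⊤)
    (hd : (d.factorial : 𝕜) ≠ 0) : Z.inverseSystem d = ⊥ := by
  refine (Submodule.eq_bot_iff _).2 fun F hF => ?_
  obtain ⟨hFd, hFZ⟩ := mem_inverseSystem.1 hF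
  refine eq_of_apolarPairing_eq hd hFd (isHomogeneous_zero _ _ d) fun H _ => ?_
  rw [hFZ H (hZ ▸ Submodule.mem_top), map_zero, LinearMap.zero_apply]

end Decomposition

end GADScheme

open GADScheme in
theorem mainTheorem6_general {𝕜 : Type*} [Field 𝕜] {ι : Type*} [Finite ι] {n d : ℕ}
    (hd : (d.factorial : 𝕜) ≠ 0) {F : MvPolynomial (Fin (n + 1)) 𝕜} (hF : F.IsHomogeneous d)
    {L : ι → Fin (n + 1) → 𝕜} (hL : ∀ i, L i ≠ 0) {kt : ι → ℕ} (hkt : ∀ i, kt i ≤ d)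
    {W : ι → ProjSubscheme 𝕜 n} (hWF : (ProjSubscheme.union W).IsApolar F)
    (hW : ∀ i, pointIdeal (L i) ^ (kt i + 1) ≤ (W i).ideal) :
    ∃ (J : Finset ι) (D : GAD d F J),
      (∀ i : J, D.L i = L i) ∧ (∀ i : J, D.k i ≤ kt i) ∧
        (ProjSubscheme.union W).Contains D.scheme := by
  have := Fintype.ofFinite ι
  obtain ⟨V, hVW, hV, hinj⟩ := ProjSubscheme.exists_union_eq_and_injOn_pointIdeal L kt hW
  rw [← hVW] at hWF ⊢
  have hF_mem : F ∈ ⨆ i, (V i).inverseSystem d := by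
    rw [← ProjSubscheme.inverseSystem_union V hd]
    exact hWF.mem_inverseSystem hF
  obtain ⟨f, hf, hsum⟩ := (Submodule.mem_iSup_iff_exists_finsupp _ _).1 hF_mem
  rw [Finsupp.sum_fintype f _ fun _ => rfl] at hsum
  have hf_ne (i : ι) (hfi : f i ≠ 0) : (V i).ideal ≠ ⊤ := fun htop =>
    hfi (by simpa only [ProjSubscheme.inverseSystem_eq_bot htop hd, Submodule.mem_bot] using hf i)
  exact exists_GAD_of_sum_eq hd hL hkt hV hf (hinj.mono hf_ne) hsum

theorem mainTheorem6 {𝕜 : Type*} [Field 𝕜] [IsAlgClosed 𝕜] [CharZero 𝕜] (n d s : ℕ)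
    (F : MvPolynomial (Fin (n + 1)) 𝕜) (hF : F.IsHomogeneous d)
    (L : Fin s → Fin (n + 1) → 𝕜) (hL : ∀ i, L i ≠ 0)
    (kt : Fin s → ℕ) (hkt : ∀ i, kt i ≤ d)
    (Z : GADScheme.ProjSubscheme 𝕜 n) (hZdim : Z.IsZeroDim) (hZF : Z.IsApolar F)
    (W : Fin s → GADScheme.ProjSubscheme 𝕜 n) (hZW : Z = GADScheme.ProjSubscheme.union W)
    (hW : ∀ i, GADScheme.pointIdeal (L i) ^ (kt i + 1) ≤ (W i).ideal) :
    ∃ (J : Finset (Fin s)) (D : GADScheme.GAD d F J),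
      (∀ i : J, D.L i = L i) ∧ (∀ i : J, D.k i ≤ kt i) ∧ Z.Contains D.scheme := by
  subst hZW
  exact mainTheorem6_general (Nat.cast_ne_zero.2 d.factorial_ne_zero) hF hL hkt hZF hW
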